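/- **Ricci curvature in action-angle coordinates.** Let $(M^{2n},\omega,g,\mu)$ be a toric Kähler manifold: a manifold of real dimension $2n$ with a Kähler structure (Riemannian metric $g$, integrable complex structure $J$ preserving $g$, closed form $\omega(\cdot,\cdot)=g(J\cdot,\cdot)$) and an effective smooth action of the torus $\mathbb T^n=(\mathbb R/2\pi\mathbb Z)^n$ preserving $g$ and $J$, with invariant moment map $\mu:M\to\mathbb R^n$, $d\mu_i=\omega(\cdot,X_i)$, where $X_i$ generates the $i$-th circle. Let $(x,\theta)\in U\times\mathbb R^n$, with $U\subset\mathbb R^n$ open (for instance $U=\operatorname{int}P$, $P=\mu(M)$), be action-angle coordinates: they are given by a local diffeomorphism $\Phi:U\times\mathbb R^n\to M$ such that $x=\mu$, $\mathbb T^n$ acts by translating $\theta$, $\theta$ is determined by the point modulo $2\pi\mathbb Z^n$, and $\omega=\sum_i dx^i\wedge d\theta^i$. Let $u:U\to\mathbb R$ be a symplectic potential, that is, a smooth function with positive definite Hessian $u_{ij}=\partial^2u/\partial x^i\partial x^j$ and inverse Hessian $(u^{ij})$ such that, in these coordinates, $$g=\sum_{i,j}\left(u_{ij}\,dx^i dx^j+u^{ij}\,d\theta^i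 d\theta^j\right).$$ Put $V=(\det(u_{ij}))^{-1/2}$. Then, in the coordinates $(x,\theta)$, the Ricci tensor of $g$ is $$\mathrm{Ric}=-\sum_{i,j,k,l=1}^n u_{il}\,\frac{\partial}{\partial x^j}\left(u^{lk}\frac{\partial\log V}{\partial x^k}\right)dx^i\otimes dx^j-\sum_{i,j,k,l=1}^n u^{ik}\,\frac{\partial}{\partial x^k}\left(u^{jl}\frac{\partial\log V}{\partial x^l}\right)d\theta^i\otimes d\theta^j ;$$ in particular its mixed components $\mathrm{Ric}(\partial_{x^i},\partial_{\theta^j})$ and $\mathrm{Ric}(\partial_{\theta^i},\partial_{x^j})$ vanish. Moreover, at every critical point $x\in U$ of $V$, $$\mathrm{Ric}(\partial_{x^i},\partial_{x^j})=-\mathrm{Hess}^{g_P}_{ij}\log V\qquad(1\le i,j\le n),$$ where $\mathrm{Hess}^{g_P}$ is the Hessian of the Levi-Civita connection of the metric $g_P=\sum u_{ij}\,dx^i dx^j$ on $U$. -/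

import Mathlib

open scoped Manifold ContDiff Bundle Matrix

/-! ### Classical Riemannian geometry in coordinates -/

/-- The partial derivative `∂f/∂z^a` of a function on the coordinate space `ℝ^ι`. -/
noncomputable def coordDeriv {ι : Type*} [Fintype ι] [DecidableEq ι]
    (a : ι) (f : (ι → ℝ) → ℝ) (z : ι → ℝ) : ℝ :=
  fderiv ℝ f z (Pi.single a 1)

/-- The Christoffel symbol `Γ^c_{ab}` of the Levi-Civita connection of the metric
`G_{ab} dz^a dz^b`:
`Γ^c_{ab} = (1/2) G^{cd} (∂_a G_{db} + ∂_b G_{ad} - ∂_d G_{ab})`. -/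
noncomputable def christoffel {ι : Type*} [Fintype ι] [DecidableEq ι]
    (G : (ι → ℝ) → Matrix ι ι ℝ) (c a b : ι) (z : ι → ℝ) : ℝ :=
  (1 / 2) * ∑ d, (G z)⁻¹ c d *
    (coordDeriv a (fun y => G y d b) z + coordDeriv b (fun y => G y a d) z
      - coordDeriv d (fun y => G y a b) z)

/-- The component `R^d_{cab}` of the Riemann curvature tensor of the metric
`G_{ab} dz^a dz^b`, that is `R(∂_a, ∂_b) ∂_c = R^d_{cab} ∂_d` for
`R(X, Y) = ∇_X ∇_Y - ∇_Y ∇_X - ∇_{[X, Y]}`. -/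
noncomputable def riemannCurvature {ι : Type*} [Fintype ι] [DecidableEq ι]
    (G : (ι → ℝ) → Matrix ι ι ℝ) (d c a b : ι) (z : ι → ℝ) : ℝ :=
  coordDeriv a (christoffel G d b c) z - coordDeriv b (christoffel G d a c) z
    + ∑ e, (christoffel G d a e z * christoffel G e b c z
      - christoffel G d b e z * christoffel G e a c z)

/-- The component `Ric(∂_b, ∂_c)` of the Ricci tensor of the metric `G_{ab} dz^a dz^b`, that is
the trace of the endomorphism `Z ↦ R(Z, ∂_b) ∂_c`. -/
noncomputable def ricciTensor {ι : Type*} [Fintype ι] [DecidableEq ι]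
    (G : (ι → ℝ) → Matrix ι ι ℝ) (z : ι → ℝ) (b c : ι) : ℝ :=
  ∑ a, riemannCurvature G a c a b z

/-- The component `(∇df)(∂_a, ∂_b)` of the Hessian of the function `f` with respect to the
metric `G_{ab} dz^a dz^b`: `∂_a ∂_b f - Γ^c_{ab} ∂_c f`. -/
noncomputable def riemannianHessian {ι : Type*} [Fintype ι] [DecidableEq ι]
    (G : (ι → ℝ) → Matrix ι ι ℝ) (f : (ι → ℝ) → ℝ) (z : ι → ℝ) (a b : ι) : ℝ :=
  coordDeriv a (coordDeriv b f) z - ∑ c, christoffel G c a b z * coordDeriv c f z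

/-- The coefficient matrix `g(∂_a, ∂_b)` of a Riemannian metric `g` on `M` in the coordinates
given by the parametrization `Φ`, where `∂_a` is the image under `dΦ` of the `a`-th basis vector. -/
noncomputable def metricCoeff {ι : Type*} [Fintype ι] [DecidableEq ι]
    {E : Type*} [NormedAddCommGroup E] [NormedSpace ℝ E]
    {M : Type*} [TopologicalSpace M] [ChartedSpace E M] [IsManifold 𝓘(ℝ, E) ∞ M]
    (g : Bundle.ContMDiffRiemannianMetric 𝓘(ℝ, E) ∞ E
      (fun p : M => TangentSpace 𝓘(ℝ, E) p))
    (Φ : (ι → ℝ) → M) (z : ι → ℝ) : Matrix ι ι ℝ :=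
  Matrix.of fun a b =>
    g.inner (Φ z) (mfderiv 𝓘(ℝ, ι → ℝ) 𝓘(ℝ, E) Φ z (Pi.single a 1 : ι → ℝ))
      (mfderiv 𝓘(ℝ, ι → ℝ) 𝓘(ℝ, E) Φ z (Pi.single b 1 : ι → ℝ))

/-! ### Toric Kähler manifolds -/

/-- The covering homomorphism from `ℝⁿ` to the torus `𝕋ⁿ = (ℝ / 2πℤ)ⁿ`. -/
noncomputable def toTorus {n : ℕ} (t : Fin n → ℝ) : Fin n → Real.Angle := fun i => (t i : Real.Angle)

/-- The value at `p` of the vector field generated by the `i`-th circle factor of the torus. -/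
noncomputable def torusGenerator (n : ℕ)
    {E : Type*} [NormedAddCommGroup E] [NormedSpace ℝ E]
    {M : Type*} [TopologicalSpace M] [ChartedSpace E M] [AddAction (Fin n → Real.Angle) M]
    (i : Fin n) (p : M) : TangentSpace 𝓘(ℝ, E) p :=
  mfderiv 𝓘(ℝ, ℝ) 𝓘(ℝ, E) (fun t : ℝ => toTorus (Pi.single i t : Fin n → ℝ) +ᵥ p) 0 (1 : ℝ)

/-- A toric Kähler structure on the manifold `M` of real dimension `2n` on which the torus `𝕋ⁿ`
acts: a Riemannian metric `g`, a complex structure `J`, with associated symplectic form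
`ω(v, w) = g(J v, w)`, and a moment map `μ` for the action. -/
structure ToricKahler (n : ℕ)
    (E : Type*) [NormedAddCommGroup E] [NormedSpace ℝ E]
    (M : Type*) [TopologicalSpace M] [ChartedSpace E M] [IsManifold 𝓘(ℝ, E) ∞ M]
    [AddAction (Fin n → Real.Angle) M] where
  finrank_eq : Module.finrank ℝ E = 2 * n
  /-- the Riemannian metric -/
  g : Bundle.ContMDiffRiemannianMetric 𝓘(ℝ, E) ∞ E (fun p : M => TangentSpace 𝓘(ℝ, E) p)
  /-- the complex structure -/
  J : ∀ p : M, TangentSpace 𝓘(ℝ, E) p →L[ℝ] TangentSpace 𝓘(ℝ, E) p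
  J_smooth : ContMDiff 𝓘(ℝ, E) (𝓘(ℝ, E).prod 𝓘(ℝ, E →L[ℝ] E)) ∞
    (fun p => Bundle.TotalSpace.mk' (E →L[ℝ] E)
      (E := fun p : M => TangentSpace 𝓘(ℝ, E) p →L[ℝ] TangentSpace 𝓘(ℝ, E) p) p (J p))
  J_sq : ∀ p v, J p (J p v) = -v
  /-- `J` is integrable: its Nijenhuis tensor vanishes. -/
  J_integrable : ∀ (X Y : ∀ p : M, TangentSpace 𝓘(ℝ, E) p) (p : M),
    ContMDiffAt 𝓘(ℝ, E) 𝓘(ℝ, E).tangent ∞ (fun q => (⟨q, X q⟩ : TangentBundle 𝓘(ℝ, E) M)) p →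
    ContMDiffAt 𝓘(ℝ, E) 𝓘(ℝ, E).tangent ∞ (fun q => (⟨q, Y q⟩ : TangentBundle 𝓘(ℝ, E) M)) p →
    VectorField.mlieBracket 𝓘(ℝ, E) (fun q => J q (X q)) (fun q => J q (Y q)) p
      - J p (VectorField.mlieBracket 𝓘(ℝ, E) (fun q => J q (X q)) Y p)
      - J p (VectorField.mlieBracket 𝓘(ℝ, E) X (fun q => J q (Y q)) p)
      - VectorField.mlieBracket 𝓘(ℝ, E) X Y p = 0
  g_J : ∀ p v w, g.inner p (J p v) (J p w) = g.inner p v w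
  /-- The form `ω(v, w) = g(J v, w)` is closed. -/
  omega_closed : ∀ (X Y Z : ∀ p : M, TangentSpace 𝓘(ℝ, E) p) (p : M),
    ContMDiffAt 𝓘(ℝ, E) 𝓘(ℝ, E).tangent ∞ (fun q => (⟨q, X q⟩ : TangentBundle 𝓘(ℝ, E) M)) p →
    ContMDiffAt 𝓘(ℝ, E) 𝓘(ℝ, E).tangent ∞ (fun q => (⟨q, Y q⟩ : TangentBundle 𝓘(ℝ, E) M)) p →
    ContMDiffAt 𝓘(ℝ, E) 𝓘(ℝ, E).tangent ∞ (fun q => (⟨q, Z q⟩ : TangentBundle 𝓘(ℝ, E) M)) p →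
    mvfderiv 𝓘(ℝ, E) (fun q => g.inner q (J q (Y q)) (Z q)) p (X p)
      + mvfderiv 𝓘(ℝ, E) (fun q => g.inner q (J q (Z q)) (X q)) p (Y p)
      + mvfderiv 𝓘(ℝ, E) (fun q => g.inner q (J q (X q)) (Y q)) p (Z p)
      - g.inner p (J p (VectorField.mlieBracket 𝓘(ℝ, E) X Y p)) (Z p)
      - g.inner p (J p (VectorField.mlieBracket 𝓘(ℝ, E) Y Z p)) (X p)
      - g.inner p (J p (VectorField.mlieBracket 𝓘(ℝ, E) Z X p)) (Y p) = 0
  action_smooth : ContMDiff (𝓘(ℝ, Fin n → ℝ).prod 𝓘(ℝ, E)) 𝓘(ℝ, E) ∞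
    (fun q : (Fin n → ℝ) × M => toTorus q.1 +ᵥ q.2)
  action_effective : ∀ a : Fin n → Real.Angle, (∀ p : M, a +ᵥ p = p) → a = 0
  action_g : ∀ (a : Fin n → Real.Angle) (p : M) (v w : TangentSpace 𝓘(ℝ, E) p),
    g.inner (a +ᵥ p) (mfderiv 𝓘(ℝ, E) 𝓘(ℝ, E) (fun q : M => a +ᵥ q) p v)
      (mfderiv 𝓘(ℝ, E) 𝓘(ℝ, E) (fun q : M => a +ᵥ q) p w) = g.inner p v w
  action_J : ∀ (a : Fin n → Real.Angle) (p : M) (v : TangentSpace 𝓘(ℝ, E) p),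
    mfderiv 𝓘(ℝ, E) 𝓘(ℝ, E) (fun q : M => a +ᵥ q) p (J p v)
      = J (a +ᵥ p) (mfderiv 𝓘(ℝ, E) 𝓘(ℝ, E) (fun q : M => a +ᵥ q) p v)
  /-- the moment map -/
  μ : M → (Fin n → ℝ)
  μ_smooth : ContMDiff 𝓘(ℝ, E) 𝓘(ℝ, Fin n → ℝ) ∞ μ
  μ_invariant : ∀ (a : Fin n → Real.Angle) (p : M), μ (a +ᵥ p) = μ p
  /-- `dμ_i = ω(·, X_i)` for the generator `X_i` of the `i`-th circle. -/
  μ_moment : ∀ (p : M) (v : TangentSpace 𝓘(ℝ, E) p) (i : Fin n),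
    mvfderiv 𝓘(ℝ, E) μ p v i
      = g.inner p (J p v) (torusGenerator n i p)

/-- The symplectic form `ω(v, w) = g(J v, w)` of a toric Kähler structure. -/
noncomputable def ToricKahler.omega {n : ℕ}
    {E : Type*} [NormedAddCommGroup E] [NormedSpace ℝ E]
    {M : Type*} [TopologicalSpace M] [ChartedSpace E M] [IsManifold 𝓘(ℝ, E) ∞ M]
    [AddAction (Fin n → Real.Angle) M] (K : ToricKahler n E M)
    (p : M) (v w : TangentSpace 𝓘(ℝ, E) p) : ℝ :=
  K.g.inner p (K.J p v) w

/-! ### Action-angle coordinates and symplectic potentials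

Coordinates `(x, θ)` on `ℝⁿ × ℝⁿ` are indexed by `Fin n ⊕ Fin n`: `x^i` has index `Sum.inl i`
and `θ^i` has index `Sum.inr i`. -/

/-- The domain `U × ℝⁿ` of the coordinates `(x, θ)`. -/
def actionAngleDomain {n : ℕ} (U : Set (Fin n → ℝ)) : Set (Fin n ⊕ Fin n → ℝ) :=
  {z | z ∘ Sum.inl ∈ U}

/-- `Φ : U × ℝⁿ → M` gives action-angle coordinates: it is a local diffeomorphism, the `x^i` are
the components of the moment map, `𝕋ⁿ` acts by translation of the angles, which are determined
by the point exactly up to multiples of `2π`, and `ω = ∑ dx^i ∧ dθ^i`. The whole interior of the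
moment polytope is the case `U = interior (Set.range K.μ)`. -/
structure IsActionAngle {n : ℕ}
    {E : Type*} [NormedAddCommGroup E] [NormedSpace ℝ E]
    {M : Type*} [TopologicalSpace M] [ChartedSpace E M] [IsManifold 𝓘(ℝ, E) ∞ M]
    [AddAction (Fin n → Real.Angle) M] (K : ToricKahler n E M)
    (U : Set (Fin n → ℝ)) (Φ : (Fin n ⊕ Fin n → ℝ) → M) : Prop where
  isOpen : IsOpen U
  localDiffeo : IsLocalDiffeomorphOn 𝓘(ℝ, Fin n ⊕ Fin n → ℝ) 𝓘(ℝ, E) ∞ Φ (actionAngleDomain U)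
  moment : ∀ z ∈ actionAngleDomain U, K.μ (Φ z) = z ∘ Sum.inl
  translation : ∀ x ∈ U, ∀ θ t : Fin n → ℝ,
    Φ (Sum.elim x (θ + t)) = toTorus t +ᵥ Φ (Sum.elim x θ)
  angle_unique : ∀ x ∈ U, ∀ θ θ' : Fin n → ℝ,
    Φ (Sum.elim x θ) = Φ (Sum.elim x θ') → toTorus θ = toTorus θ'
  darboux : ∀ z ∈ actionAngleDomain U, ∀ v w : Fin n ⊕ Fin n → ℝ,
    K.omega (Φ z) (mfderiv 𝓘(ℝ, Fin n ⊕ Fin n → ℝ) 𝓘(ℝ, E) Φ z v)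
        (mfderiv 𝓘(ℝ, Fin n ⊕ Fin n → ℝ) 𝓘(ℝ, E) Φ z w)
      = ∑ i, (v (Sum.inl i) * w (Sum.inr i) - v (Sum.inr i) * w (Sum.inl i))

/-- The Hessian matrix `u_{ij} = ∂²u / ∂x^i ∂x^j`. -/
noncomputable def hessMatrix {n : ℕ} (u : (Fin n → ℝ) → ℝ) (x : Fin n → ℝ) :
    Matrix (Fin n) (Fin n) ℝ :=
  Matrix.of fun i j => coordDeriv i (coordDeriv j u) x

/-- `u` is a symplectic potential of the toric Kähler metric in the action-angle coordinates
`(x, θ)`: it is smooth and strictly convex, and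
`g = u_{ij} dx^i dx^j + u^{ij} dθ^i dθ^j`, where `(u^{ij})` is the inverse of `(u_{ij})`. -/
structure IsSymplecticPotential {n : ℕ}
    {E : Type*} [NormedAddCommGroup E] [NormedSpace ℝ E]
    {M : Type*} [TopologicalSpace M] [ChartedSpace E M] [IsManifold 𝓘(ℝ, E) ∞ M]
    [AddAction (Fin n → Real.Angle) M] (K : ToricKahler n E M)
    (U : Set (Fin n → ℝ)) (Φ : (Fin n ⊕ Fin n → ℝ) → M) (u : (Fin n → ℝ) → ℝ) : Prop where
  smooth : ContDiffOn ℝ ∞ u U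
  posDef : ∀ x ∈ U, (hessMatrix u x).PosDef
  metric : ∀ z ∈ actionAngleDomain U,
    metricCoeff K.g Φ z =
      Matrix.fromBlocks (hessMatrix u (z ∘ Sum.inl)) 0 0 (hessMatrix u (z ∘ Sum.inl))⁻¹

/-- The orbital volume function `V = (det Hess u)^{-1/2}`. -/
noncomputable def orbitVolume {n : ℕ} (u : (Fin n → ℝ) → ℝ) (x : Fin n → ℝ) : ℝ :=
  (hessMatrix u x).det ^ (-(1 / 2) : ℝ)

/-!
# Ricci curvature in action-angle coordinates

The Ricci tensor at a point depends only on the germ of the metric, so the statement concerns the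
metric `h_{ij} dx^i dx^j + h^{ij} dθ^i dθ^j` on `U × ℝⁿ`, where `h` is the Hessian matrix of the
symplectic potential (`torusInvariantMetric`). Of the relation `h_{ij} = ∂_i ∂_j u` only the total
symmetry of `∂_a h_{bc}` matters (`IsHessianMetric`).

Two facts make the computation short. First, this metric has determinant `1`, so the contracted
Christoffel symbols `Γ^a_{ac}` vanish (`IsHessianMetric.sum_christoffel_eq_zero`) and
`Ric_{bc} = ∂_a Γ^a_{bc} - Γ^a_{be} Γ^e_{ac}` (`ricciTensor_of_sum_christoffel_eq_zero`). Second,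
Jacobi's formula for the derivative of the determinant and the total symmetry of `∂_a h_{bc}` give
`∂_a h^{ac} = 2 h^{cp} ∂_p log V` (`IsHessianMetric.sum_matrixDeriv_inv`).

If the Christoffel symbols are written as
`Γ^{x_a}_{x_b x_c} = -(1/2) ∂_c h^{ad} h_{db}` and
`Γ^{x_a}_{θ_b θ_c} = -(1/2) h^{bd} ∂_d h^{ac}`, the part of `∂_a Γ^a_{bc}` containing second
derivatives of `h⁻¹` is a derivative of the divergence `∂_a h^{ad}`, hence of the gradient of
`log V`. The remaining part is quadratic in first derivatives and equals `Γ^a_{be} Γ^e_{ac}`, so it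
cancels (`IsHessianMetric.ricciTensor_inl_inl`, `IsHessianMetric.ricciTensor_inr_inr`).

At a critical point of `V` the gradient of `log V` vanishes, and both the Ricci tensor and the
Hessian of `log V` reduce to second partial derivatives of `log V`.
-/

/-! ### Calculus of partial derivatives -/

section Calculus

open Filter Topology

variable {ι : Type*} [Fintype ι]

lemma differentiableAt_of_contDiffOn {U : Set (ι → ℝ)} (hU : IsOpen U) {f : (ι → ℝ) → ℝ}
    (hf : ContDiffOn ℝ ∞ f U) {z : ι → ℝ} (hz : z ∈ U) : DifferentiableAt ℝ f z :=
  (hf.contDiffAt (hU.mem_nhds hz)).differentiableAt (by simp)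

/-- The projection `(x, θ) ↦ x` as a continuous linear map. -/
noncomputable def projInl (ι : Type*) [Fintype ι] : (ι ⊕ ι → ℝ) →L[ℝ] (ι → ℝ) :=
  ContinuousLinearMap.pi fun i => ContinuousLinearMap.proj (Sum.inl i)

lemma projInl_apply (z : ι ⊕ ι → ℝ) : projInl ι z = z ∘ Sum.inl := rfl

lemma eventually_comp_inl_mem {U : Set (ι → ℝ)} (hU : IsOpen U) {z : ι ⊕ ι → ℝ}
    (hz : z ∘ Sum.inl ∈ U) : ∀ᶠ y in 𝓝 z, y ∘ Sum.inl ∈ U :=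
  (projInl ι).continuous.continuousAt.eventually_mem (hU.mem_nhds hz)

lemma hasFDerivAt_of_eq_comp_inl {U : Set (ι → ℝ)} (hU : IsOpen U) {F : (ι ⊕ ι → ℝ) → ℝ}
    {f : (ι → ℝ) → ℝ} (hF : ∀ y, y ∘ Sum.inl ∈ U → F y = f (y ∘ Sum.inl)) {z : ι ⊕ ι → ℝ}
    (hz : z ∘ Sum.inl ∈ U) (hf : DifferentiableAt ℝ f (z ∘ Sum.inl)) :
    HasFDerivAt F ((fderiv ℝ f (z ∘ Sum.inl)).comp (projInl ι)) z :=
  ((hf.hasFDerivAt (x := projInl ι z)).comp z (projInl ι).hasFDerivAt).congr_of_eventuallyEq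
    ((eventually_comp_inl_mem hU hz).mono hF)

variable [DecidableEq ι]

lemma coordDeriv_congr {f g : (ι → ℝ) → ℝ} {z : ι → ℝ} (a : ι) (h : f =ᶠ[𝓝 z] g) :
    coordDeriv a f z = coordDeriv a g z := by
  simp only [coordDeriv, h.fderiv_eq]

lemma coordDeriv_congr_on {U : Set (ι → ℝ)} (hU : IsOpen U) {f g : (ι → ℝ) → ℝ}
    (h : ∀ y ∈ U, f y = g y) {z : ι → ℝ} (hz : z ∈ U) (a : ι) :
    coordDeriv a f z = coordDeriv a g z :=
  coordDeriv_congr a (Filter.eventually_of_mem (hU.mem_nhds hz) h)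

lemma coordDeriv_const (a : ι) (c : ℝ) (z : ι → ℝ) : coordDeriv a (fun _ => c) z = 0 := by
  simp [coordDeriv]

lemma coordDeriv_mul (a : ι) {f g : (ι → ℝ) → ℝ} {z : ι → ℝ} (hf : DifferentiableAt ℝ f z)
    (hg : DifferentiableAt ℝ g z) :
    coordDeriv a (fun y => f y * g y) z = coordDeriv a f z * g z + f z * coordDeriv a g z := by
  simp only [coordDeriv]
  rw [fderiv_fun_mul hf hg]
  simp
  ring

lemma coordDeriv_const_mul (a : ι) (c : ℝ) {f : (ι → ℝ) → ℝ} {z : ι → ℝ}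
    (hf : DifferentiableAt ℝ f z) :
    coordDeriv a (fun y => c * f y) z = c * coordDeriv a f z := by
  simp only [coordDeriv]
  rw [fderiv_const_mul hf]
  simp

lemma coordDeriv_sum {κ : Type*} (s : Finset κ) (a : ι) {f : κ → (ι → ℝ) → ℝ} {z : ι → ℝ}
    (hf : ∀ k ∈ s, DifferentiableAt ℝ (f k) z) :
    coordDeriv a (fun y => ∑ k ∈ s, f k y) z = ∑ k ∈ s, coordDeriv a (f k) z := by
  simp only [coordDeriv]
  rw [fderiv_fun_sum hf]
  simp

lemma coordDeriv_log (a : ι) {f : (ι → ℝ) → ℝ} {z : ι → ℝ} (hf : DifferentiableAt ℝ f z)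
    (h0 : f z ≠ 0) : coordDeriv a (fun y => Real.log (f y)) z = (f z)⁻¹ * coordDeriv a f z := by
  simp only [coordDeriv]
  rw [fderiv.log hf h0]
  simp

lemma contDiffOn_coordDeriv {U : Set (ι → ℝ)} (hU : IsOpen U) {f : (ι → ℝ) → ℝ}
    (hf : ContDiffOn ℝ ∞ f U) (a : ι) : ContDiffOn ℝ ∞ (coordDeriv a f) U :=
  (hf.fderiv_of_isOpen hU (by simp)).clm_apply contDiffOn_const

lemma coordDeriv_comm {U : Set (ι → ℝ)} (hU : IsOpen U) {f : (ι → ℝ) → ℝ}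
    (hf : ContDiffOn ℝ ∞ f U) {z : ι → ℝ} (hz : z ∈ U) (a b : ι) :
    coordDeriv a (coordDeriv b f) z = coordDeriv b (coordDeriv a f) z := by
  have hd : DifferentiableAt ℝ (fderiv ℝ f) z :=
    ((hf.fderiv_of_isOpen hU (m := ∞) (by simp)).contDiffAt (hU.mem_nhds hz)).differentiableAt
      (by simp)
  have key : ∀ a b : ι, coordDeriv a (coordDeriv b f) z
      = fderiv ℝ (fderiv ℝ f) z (Pi.single a 1) (Pi.single b 1) := by
    intro a b
    change fderiv ℝ (fun y => fderiv ℝ f y (Pi.single b 1)) z (Pi.single a 1) = _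
    rw [fderiv_clm_apply hd (differentiableAt_const _)]
    simp
  rw [key, key]
  exact (contDiffAt_infty.1 (hf.contDiffAt (hU.mem_nhds hz)) 2).isSymmSndFDerivAt
    (by simp) _ _

lemma coordDeriv_inl_of_eq_comp_inl {U : Set (ι → ℝ)} (hU : IsOpen U) {F : (ι ⊕ ι → ℝ) → ℝ}
    {f : (ι → ℝ) → ℝ} (hF : ∀ y, y ∘ Sum.inl ∈ U → F y = f (y ∘ Sum.inl)) {z : ι ⊕ ι → ℝ}
    (hz : z ∘ Sum.inl ∈ U) (hf : DifferentiableAt ℝ f (z ∘ Sum.inl)) (a : ι) :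
    coordDeriv (Sum.inl a) F z = coordDeriv a f (z ∘ Sum.inl) := by
  have : projInl ι (Pi.single (Sum.inl a) 1) = Pi.single a 1 := by
    ext i; simp [projInl_apply, Pi.single_apply]
  simp [coordDeriv, (hasFDerivAt_of_eq_comp_inl hU hF hz hf).fderiv, this]

lemma coordDeriv_inr_of_eq_comp_inl {U : Set (ι → ℝ)} (hU : IsOpen U) {F : (ι ⊕ ι → ℝ) → ℝ}
    {f : (ι → ℝ) → ℝ} (hF : ∀ y, y ∘ Sum.inl ∈ U → F y = f (y ∘ Sum.inl)) {z : ι ⊕ ι → ℝ}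
    (hz : z ∘ Sum.inl ∈ U) (hf : DifferentiableAt ℝ f (z ∘ Sum.inl)) (a : ι) :
    coordDeriv (Sum.inr a) F z = 0 := by
  have : projInl ι (Pi.single (Sum.inr a) 1) = 0 := by
    ext i; simp [projInl_apply]
  simp [coordDeriv, (hasFDerivAt_of_eq_comp_inl hU hF hz hf).fderiv, this]

end Calculus

/-! ### Derivatives of matrix-valued functions -/

section MatrixCalculus

variable {ι κ : Type*} [Fintype ι]

section

variable [Fintype κ] [DecidableEq κ]

lemma contDiffOn_det {U : Set (ι → ℝ)} {A : (ι → ℝ) → Matrix κ κ ℝ}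
    (hA : ∀ i j, ContDiffOn ℝ ∞ (fun y => A y i j) U) :
    ContDiffOn ℝ ∞ (fun y => (A y).det) U := by
  simp only [Matrix.det_apply']
  exact ContDiffOn.sum fun σ _ => contDiffOn_const.mul (contDiffOn_prod fun i _ => hA _ _)

lemma contDiffOn_matrix_inv {U : Set (ι → ℝ)} {A : (ι → ℝ) → Matrix κ κ ℝ}
    (hA : ∀ i j, ContDiffOn ℝ ∞ (fun y => A y i j) U) (h0 : ∀ y ∈ U, (A y).det ≠ 0) (i j : κ) :
    ContDiffOn ℝ ∞ (fun y => (A y)⁻¹ i j) U := by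
  simp only [Matrix.inv_def, Matrix.smul_apply, Ring.inverse_eq_inv', smul_eq_mul,
    Matrix.adjugate_apply]
  refine ((contDiffOn_det hA).inv h0).mul (contDiffOn_det fun k l => ?_)
  by_cases hk : k = j
  · subst hk
    simpa only [Matrix.updateRow_self] using contDiffOn_const
  · simpa only [Matrix.updateRow_ne hk] using hA k l

end

variable [DecidableEq ι]

/-- The entrywise partial derivative `∂A/∂z^a` of a matrix-valued function. -/
noncomputable def matrixDeriv (a : ι) (A : (ι → ℝ) → Matrix κ κ ℝ) (z : ι → ℝ) : Matrix κ κ ℝ :=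
  Matrix.of fun i j => coordDeriv a (fun y => A y i j) z

lemma matrixDeriv_apply (a : ι) (A : (ι → ℝ) → Matrix κ κ ℝ) (z : ι → ℝ) (i j : κ) :
    matrixDeriv a A z i j = coordDeriv a (fun y => A y i j) z := rfl

variable [Fintype κ]

lemma matrixDeriv_mul (a : ι) {A B : (ι → ℝ) → Matrix κ κ ℝ} {z : ι → ℝ}
    (hA : ∀ i j, DifferentiableAt ℝ (fun y => A y i j) z)
    (hB : ∀ i j, DifferentiableAt ℝ (fun y => B y i j) z) :
    matrixDeriv a (fun y => A y * B y) z = matrixDeriv a A z * B z + A z * matrixDeriv a B z := by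
  ext i j
  simp only [matrixDeriv_apply, Matrix.add_apply, Matrix.mul_apply]
  rw [coordDeriv_sum _ _ fun k _ => (hA i k).fun_mul (hB k j), ← Finset.sum_add_distrib]
  exact Finset.sum_congr rfl fun k _ => coordDeriv_mul a (hA i k) (hB k j)

variable [DecidableEq κ]

/-- **Jacobi's formula**: `∂_a det A = det A · tr (A⁻¹ ∂_a A)`. -/
lemma coordDeriv_det (a : ι) {A : (ι → ℝ) → Matrix κ κ ℝ} {z : ι → ℝ}
    (hA : ∀ i j, DifferentiableAt ℝ (fun y => A y i j) z) (h0 : (A z).det ≠ 0) :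
    coordDeriv a (fun y => (A y).det) z
      = (A z).det * ((A z)⁻¹ * matrixDeriv a A z).trace := by
  -- The product rule replaces one column at a time, as in Cramer's rule for `A⁻¹`.
  have hprod : ∀ σ : Equiv.Perm κ, coordDeriv a (fun y => ∏ i, A y (σ i) i) z
      = ∑ i, ∏ j, (A z).updateCol i (fun k => matrixDeriv a A z k i) (σ j) j := by
    intro σ
    simp only [coordDeriv]
    rw [(HasFDerivAt.finsetProd fun i (_ : i ∈ Finset.univ) =>
      (hA (σ i) i).hasFDerivAt).fderiv]
    rw [sum_apply]
    refine Finset.sum_congr rfl fun i _ => ?_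
    rw [← Finset.mul_prod_erase _ _ (Finset.mem_univ i), Matrix.updateCol_self, mul_comm]
    simp only [smul_apply, smul_eq_mul]
    congr 1
    refine Finset.prod_congr rfl fun j hj => ?_
    rw [Matrix.updateCol_ne (Finset.ne_of_mem_erase hj)]
  have hd : ∀ σ : Equiv.Perm κ, DifferentiableAt ℝ (fun y => ∏ i, A y (σ i) i) z := fun σ =>
    (HasFDerivAt.finsetProd fun i (_ : i ∈ Finset.univ) =>
      (hA (σ i) i).hasFDerivAt).differentiableAt
  have hadj : (A z).adjugate = (A z).det • (A z)⁻¹ := by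
    rw [Matrix.inv_def, smul_smul, Ring.inverse_eq_inv', mul_inv_cancel₀ h0, one_smul]
  calc coordDeriv a (fun y => (A y).det) z
      = ∑ i, ((A z).updateCol i (fun k => matrixDeriv a A z k i)).det := by
        simp only [Matrix.det_apply']
        rw [coordDeriv_sum _ _ fun σ _ => (hd σ).const_mul _, Finset.sum_comm]
        refine Finset.sum_congr rfl fun σ _ => ?_
        rw [coordDeriv_const_mul _ _ (hd σ), hprod, Finset.mul_sum]
    _ = ((A z).adjugate * matrixDeriv a A z).trace := by
        refine Finset.sum_congr rfl fun i _ => ?_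
        rw [← Matrix.cramer_apply, Matrix.cramer_eq_adjugate_mulVec]
        rfl
    _ = _ := by rw [hadj, Matrix.smul_mul, Matrix.trace_smul, smul_eq_mul]

end MatrixCalculus

/-! ### Hessian metrics -/

section HessianMetric

open Filter Topology

variable {ι : Type*} [Fintype ι] [DecidableEq ι]

/-- A Hessian metric on the open set `U`, described by its coefficient matrix `h`: a smooth
Riemannian metric whose first derivatives `∂_a h_{bc}` are totally symmetric, as is the case for
`h_{bc} = ∂_b ∂_c u`. -/
structure IsHessianMetric (U : Set (ι → ℝ)) (h : (ι → ℝ) → Matrix ι ι ℝ) : Prop where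
  isOpen : IsOpen U
  smooth : ∀ i j, ContDiffOn ℝ ∞ (fun y => h y i j) U
  posDef : ∀ y ∈ U, (h y).PosDef
  codazzi : ∀ y ∈ U, ∀ a b c, matrixDeriv a h y b c = matrixDeriv b h y a c

/-- The logarithm of `(det h)^{-1/2}`. -/
noncomputable def logVolume (h : (ι → ℝ) → Matrix ι ι ℝ) (y : ι → ℝ) : ℝ :=
  Real.log ((h y).det ^ (-(1 / 2) : ℝ))

/-- The component `h^{cp} ∂_p log V` of the gradient of `log V`, where `V = (det h)^{-1/2}`. -/
noncomputable def logVolumeGradient (h : (ι → ℝ) → Matrix ι ι ℝ) (c : ι) (y : ι → ℝ) : ℝ :=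
  ∑ p, (h y)⁻¹ c p * coordDeriv p (logVolume h) y

namespace IsHessianMetric

variable {U : Set (ι → ℝ)} {h : (ι → ℝ) → Matrix ι ι ℝ}

lemma det_pos (H : IsHessianMetric U h) {y : ι → ℝ} (hy : y ∈ U) : 0 < (h y).det :=
  (H.posDef y hy).det_pos

lemma symm (H : IsHessianMetric U h) {y : ι → ℝ} (hy : y ∈ U) (i j : ι) : h y i j = h y j i := by
  simpa using (H.posDef y hy).isHermitian.apply j i

lemma inv_symm (H : IsHessianMetric U h) {y : ι → ℝ} (hy : y ∈ U) (i j : ι) :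
    (h y)⁻¹ i j = (h y)⁻¹ j i := by
  simpa using (H.posDef y hy).inv.isHermitian.apply j i

lemma mul_inv (H : IsHessianMetric U h) {y : ι → ℝ} (hy : y ∈ U) : h y * (h y)⁻¹ = 1 :=
  Matrix.mul_nonsing_inv _ (H.det_pos hy).ne'.isUnit

lemma inv_mul (H : IsHessianMetric U h) {y : ι → ℝ} (hy : y ∈ U) : (h y)⁻¹ * h y = 1 :=
  Matrix.nonsing_inv_mul _ (H.det_pos hy).ne'.isUnit

lemma smooth_inv (H : IsHessianMetric U h) (i j : ι) :
    ContDiffOn ℝ ∞ (fun y => (h y)⁻¹ i j) U :=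
  contDiffOn_matrix_inv H.smooth (fun _ hy => (H.det_pos hy).ne') i j

lemma smooth_matrixDeriv_inv (H : IsHessianMetric U h) (a i j : ι) :
    ContDiffOn ℝ ∞ (fun y => matrixDeriv a (fun y => (h y)⁻¹) y i j) U :=
  contDiffOn_coordDeriv H.isOpen (H.smooth_inv i j) a

lemma differentiableAt (H : IsHessianMetric U h) {f : (ι → ℝ) → ℝ} (hf : ContDiffOn ℝ ∞ f U)
    {y : ι → ℝ} (hy : y ∈ U) : DifferentiableAt ℝ f y :=
  differentiableAt_of_contDiffOn H.isOpen hf hy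

lemma matrixDeriv_symm (H : IsHessianMetric U h) {y : ι → ℝ} (hy : y ∈ U) (a i j : ι) :
    matrixDeriv a h y i j = matrixDeriv a h y j i :=
  coordDeriv_congr_on H.isOpen (fun _ hw => H.symm hw i j) hy a

lemma matrixDeriv_inv_symm (H : IsHessianMetric U h) {y : ι → ℝ} (hy : y ∈ U) (a i j : ι) :
    matrixDeriv a (fun y => (h y)⁻¹) y i j = matrixDeriv a (fun y => (h y)⁻¹) y j i :=
  coordDeriv_congr_on H.isOpen (fun _ hw => H.inv_symm hw i j) hy a

lemma matrixDeriv_inv_mul (H : IsHessianMetric U h) {y : ι → ℝ} (hy : y ∈ U) (a : ι) :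
    matrixDeriv a (fun y => (h y)⁻¹) y * h y = -((h y)⁻¹ * matrixDeriv a h y) := by
  have h1 := matrixDeriv_mul a (A := fun y => (h y)⁻¹) (B := h)
    (fun i j => H.differentiableAt (H.smooth_inv i j) hy)
    (fun i j => H.differentiableAt (H.smooth i j) hy)
  have h2 : matrixDeriv a (fun y => (h y)⁻¹ * h y) y = 0 := by
    ext i j
    rw [matrixDeriv_apply, coordDeriv_congr_on H.isOpen
      (g := fun _ => (1 : Matrix ι ι ℝ) i j) (fun w hw => by rw [H.inv_mul hw]) hy]
    exact coordDeriv_const _ _ _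
  exact eq_neg_of_add_eq_zero_left (h1.symm.trans h2)

lemma matrixDeriv_inv (H : IsHessianMetric U h) {y : ι → ℝ} (hy : y ∈ U) (a : ι) :
    matrixDeriv a (fun y => (h y)⁻¹) y = -((h y)⁻¹ * matrixDeriv a h y * (h y)⁻¹) := by
  rw [← Matrix.neg_mul, ← H.matrixDeriv_inv_mul hy, Matrix.mul_assoc, H.mul_inv hy, Matrix.mul_one]

lemma mul_matrixDeriv_inv (H : IsHessianMetric U h) {y : ι → ℝ} (hy : y ∈ U) (a : ι) :
    h y * matrixDeriv a (fun y => (h y)⁻¹) y = -(matrixDeriv a h y * (h y)⁻¹) := by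
  rw [H.matrixDeriv_inv hy, Matrix.mul_neg, ← Matrix.mul_assoc, ← Matrix.mul_assoc, H.mul_inv hy,
    Matrix.one_mul]

/-- The derivatives `h^{cd} ∂_d h^{ab}` of the inverse matrix are totally symmetric: they arise from
`-∂_a h_{bc}` by raising all indices. -/
lemma sum_inv_mul_matrixDeriv_inv_comm (H : IsHessianMetric U h) {y : ι → ℝ} (hy : y ∈ U)
    (a b c : ι) :
    ∑ d, (h y)⁻¹ c d * matrixDeriv d (fun y => (h y)⁻¹) y a b
      = ∑ d, (h y)⁻¹ a d * matrixDeriv d (fun y => (h y)⁻¹) y c b := by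
  have key : ∀ a c, ∑ d, (h y)⁻¹ c d * matrixDeriv d (fun y => (h y)⁻¹) y a b
      = -∑ d, ∑ p, ∑ q, (h y)⁻¹ c d * ((h y)⁻¹ a p * matrixDeriv d h y p q * (h y)⁻¹ q b) := by
    intro a c
    rw [← Finset.sum_neg_distrib]
    refine Finset.sum_congr rfl fun d _ => ?_
    rw [H.matrixDeriv_inv hy, Matrix.neg_apply, Matrix.mul_apply, mul_neg, neg_inj]
    simp only [Matrix.mul_apply, Finset.sum_mul, Finset.mul_sum]
    rw [Finset.sum_comm]
  rw [key, key, Finset.sum_comm]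
  refine congrArg Neg.neg (Finset.sum_congr rfl fun p _ => Finset.sum_congr rfl fun d _ =>
    Finset.sum_congr rfl fun q _ => ?_)
  rw [H.codazzi y hy d p q]
  ring

lemma coordDeriv_logVolume (H : IsHessianMetric U h) {y : ι → ℝ} (hy : y ∈ U) (a : ι) :
    coordDeriv a (logVolume h) y = -(1 / 2) * ((h y)⁻¹ * matrixDeriv a h y).trace := by
  have hd : DifferentiableAt ℝ (fun y => (h y).det) y :=
    H.differentiableAt (contDiffOn_det H.smooth) hy
  have h0 := (H.det_pos hy).ne'
  have hlog : ∀ w ∈ U, logVolume h w = -(1 / 2) * Real.log (h w).det := fun w hw =>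
    Real.log_rpow (H.det_pos hw) _
  rw [coordDeriv_congr_on H.isOpen hlog hy, coordDeriv_const_mul _ _ (hd.log h0),
    coordDeriv_log _ hd h0, coordDeriv_det _ (fun i j => H.differentiableAt (H.smooth i j) hy) h0,
    inv_mul_cancel_left₀ h0]

lemma smooth_logVolume (H : IsHessianMetric U h) : ContDiffOn ℝ ∞ (logVolume h) U := by
  have : ContDiffOn ℝ ∞ (fun y => -(1 / 2) * Real.log (h y).det) U :=
    contDiffOn_const.mul ((contDiffOn_det H.smooth).log fun y hy => (H.det_pos hy).ne')
  exact this.congr fun y hy => Real.log_rpow (H.det_pos hy) _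

lemma smooth_logVolumeGradient (H : IsHessianMetric U h) (c : ι) :
    ContDiffOn ℝ ∞ (logVolumeGradient h c) U :=
  ContDiffOn.sum fun p _ =>
    (H.smooth_inv c p).mul (contDiffOn_coordDeriv H.isOpen H.smooth_logVolume p)

/-- The divergence of the inverse matrix is twice the gradient of `log V`. Total symmetry of
`∂_a h_{bc}` turns the contraction `h^{ap} ∂_a h_{pq}` into the trace `h^{ap} ∂_q h_{ap}`, which
Jacobi's formula identifies with `∂_q log det h`. -/
lemma sum_matrixDeriv_inv (H : IsHessianMetric U h) {y : ι → ℝ} (hy : y ∈ U) (c : ι) :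
    ∑ a, matrixDeriv a (fun y => (h y)⁻¹) y a c = 2 * logVolumeGradient h c y := by
  simp only [logVolumeGradient, H.coordDeriv_logVolume hy, H.matrixDeriv_inv hy, Matrix.neg_apply,
    Matrix.mul_apply, Matrix.trace, Matrix.diag, Finset.sum_mul, Finset.mul_sum]
  rw [Finset.sum_comm]
  simp only [← Finset.sum_neg_distrib]
  refine Finset.sum_congr rfl fun q _ => Finset.sum_congr rfl fun a _ =>
    Finset.sum_congr rfl fun p _ => ?_
  -- Total symmetry: `∂_a h_{pq} = ∂_q h_{pa}`.
  rw [H.codazzi y hy a p q, H.matrixDeriv_symm hy p a q, H.codazzi y hy p q a,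
    H.inv_symm hy a c]
  ring

/-- The second-order version of `sum_matrixDeriv_inv`. -/
lemma sum_coordDeriv_matrixDeriv_inv (H : IsHessianMetric U h) {y : ι → ℝ} (hy : y ∈ U)
    (b c : ι) :
    ∑ a, coordDeriv a (fun y => matrixDeriv b (fun y => (h y)⁻¹) y a c) y
      = 2 * coordDeriv b (logVolumeGradient h c) y := by
  rw [← coordDeriv_const_mul _ _ (H.differentiableAt (H.smooth_logVolumeGradient c) hy),
    ← coordDeriv_congr_on H.isOpen (fun w hw => H.sum_matrixDeriv_inv hw c) hy,
    coordDeriv_sum _ _ fun a _ => H.differentiableAt (H.smooth_matrixDeriv_inv a a c) hy]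
  exact Finset.sum_congr rfl fun a _ => coordDeriv_comm H.isOpen (H.smooth_inv a c) hy a b

end IsHessianMetric
end HessianMetric

/-! ### Christoffel symbols and Ricci tensor of a general metric -/

section Ricci

open Filter Topology

variable {ι : Type*} [Fintype ι] [DecidableEq ι]

lemma christoffel_congr {G G' : (ι → ℝ) → Matrix ι ι ℝ} {z : ι → ℝ} (hG : G =ᶠ[𝓝 z] G')
    (c a b : ι) : christoffel G c a b =ᶠ[𝓝 z] christoffel G' c a b := by
  filter_upwards [hG.eventuallyEq_nhds] with y hy
  have hd : ∀ k i j, coordDeriv k (fun w => G w i j) y = coordDeriv k (fun w => G' w i j) y :=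
    fun k i j => coordDeriv_congr k (hy.mono fun w hw => by simp only [hw])
  simp only [christoffel, hd, hy.eq_of_nhds]

lemma ricciTensor_congr {G G' : (ι → ℝ) → Matrix ι ι ℝ} {z : ι → ℝ} (hG : G =ᶠ[𝓝 z] G')
    (b c : ι) : ricciTensor G z b c = ricciTensor G' z b c := by
  simp only [ricciTensor, riemannCurvature, (christoffel_congr hG _ _ _).eq_of_nhds,
    fun k c a b => coordDeriv_congr k (christoffel_congr hG c a b)]

/-- In coordinates whose volume density is constant, that is, where the contracted Christoffel
symbols `Γ^a_{ac}` vanish, two of the four terms of the Ricci tensor drop out. -/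
lemma ricciTensor_of_sum_christoffel_eq_zero {G : (ι → ℝ) → Matrix ι ι ℝ} {z : ι → ℝ}
    (h0 : ∀ᶠ y in 𝓝 z, ∀ c, ∑ a, christoffel G a a c y = 0)
    (hd : ∀ a c, DifferentiableAt ℝ (christoffel G a a c) z) (b c : ι) :
    ricciTensor G z b c = ∑ a, coordDeriv a (christoffel G a b c) z
      - ∑ a, ∑ e, christoffel G a b e z * christoffel G e a c z := by
  have h1 : ∑ a, coordDeriv b (christoffel G a a c) z = 0 := by
    rw [← coordDeriv_sum _ _ fun a _ => hd a c,
      coordDeriv_congr b (g := fun _ => 0) (h0.mono fun y hy => hy c), coordDeriv_const]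
  have h2 : ∑ a, ∑ e, christoffel G a a e z * christoffel G e b c z = 0 := by
    rw [Finset.sum_comm]
    simp only [← Finset.sum_mul, h0.self_of_nhds, zero_mul, Finset.sum_const_zero]
  simp only [ricciTensor, riemannCurvature, Finset.sum_add_distrib, Finset.sum_sub_distrib, h1, h2]
  ring

end Ricci

/-! ### The Kähler metric of a Hessian metric -/

section HessianKahler

open Filter Topology

variable {ι : Type*} [Fintype ι] [DecidableEq ι]

/-- The metric `h_{ij} dx^i dx^j + h^{ij} dθ^i dθ^j` in the coordinates `(x, θ)`. -/
noncomputable def torusInvariantMetric (h : (ι → ℝ) → Matrix ι ι ℝ) (z : ι ⊕ ι → ℝ) :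
    Matrix (ι ⊕ ι) (ι ⊕ ι) ℝ :=
  Matrix.fromBlocks (h (z ∘ Sum.inl)) 0 0 (h (z ∘ Sum.inl))⁻¹

namespace IsHessianMetric

variable {U : Set (ι → ℝ)} {h : (ι → ℝ) → Matrix ι ι ℝ} {z : ι ⊕ ι → ℝ}

lemma inv_torusInvariantMetric (H : IsHessianMetric U h) (hz : z ∘ Sum.inl ∈ U) :
    (torusInvariantMetric h z)⁻¹
      = Matrix.fromBlocks (h (z ∘ Sum.inl))⁻¹ 0 0 (h (z ∘ Sum.inl)) := by
  refine Matrix.inv_eq_right_inv ?_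
  simp [torusInvariantMetric, Matrix.fromBlocks_multiply, H.mul_inv hz, H.inv_mul hz]

lemma coordDeriv_inl_metric_inl (H : IsHessianMetric U h) (hz : z ∘ Sum.inl ∈ U) (a i j : ι) :
    coordDeriv (Sum.inl a) (fun y => torusInvariantMetric h y (Sum.inl i) (Sum.inl j)) z
      = matrixDeriv a h (z ∘ Sum.inl) i j :=
  coordDeriv_inl_of_eq_comp_inl H.isOpen (fun _ _ => rfl) hz
    (H.differentiableAt (H.smooth i j) hz) a

lemma coordDeriv_inr_metric_inl (H : IsHessianMetric U h) (hz : z ∘ Sum.inl ∈ U) (a i j : ι) :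
    coordDeriv (Sum.inr a) (fun y => torusInvariantMetric h y (Sum.inl i) (Sum.inl j)) z = 0 :=
  coordDeriv_inr_of_eq_comp_inl (f := fun y => h y i j) H.isOpen (fun _ _ => rfl) hz
    (H.differentiableAt (H.smooth i j) hz) a

lemma coordDeriv_inl_metric_inr (H : IsHessianMetric U h) (hz : z ∘ Sum.inl ∈ U) (a i j : ι) :
    coordDeriv (Sum.inl a) (fun y => torusInvariantMetric h y (Sum.inr i) (Sum.inr j)) z
      = matrixDeriv a (fun y => (h y)⁻¹) (z ∘ Sum.inl) i j :=
  coordDeriv_inl_of_eq_comp_inl H.isOpen (fun _ _ => rfl) hz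
    (H.differentiableAt (H.smooth_inv i j) hz) a

lemma coordDeriv_inr_metric_inr (H : IsHessianMetric U h) (hz : z ∘ Sum.inl ∈ U) (a i j : ι) :
    coordDeriv (Sum.inr a) (fun y => torusInvariantMetric h y (Sum.inr i) (Sum.inr j)) z = 0 :=
  coordDeriv_inr_of_eq_comp_inl (f := fun y => (h y)⁻¹ i j) H.isOpen (fun _ _ => rfl) hz
    (H.differentiableAt (H.smooth_inv i j) hz) a


lemma coordDeriv_metric_inl_inr (k : ι ⊕ ι) (i j : ι) :
    coordDeriv k (fun y => torusInvariantMetric h y (Sum.inl i) (Sum.inr j)) z = 0 :=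
  coordDeriv_const _ _ _

lemma coordDeriv_metric_inr_inl (k : ι ⊕ ι) (i j : ι) :
    coordDeriv k (fun y => torusInvariantMetric h y (Sum.inr i) (Sum.inl j)) z = 0 :=
  coordDeriv_const _ _ _

/-- The Christoffel symbols `(1/2) h^{cd} ∂_b h_{da}` of a Hessian metric, with the derivative
moved onto the inverse matrix. This is the form whose divergence over `c` involves `∂_c h^{cd}`. -/
lemma christoffel_eq (H : IsHessianMetric U h) {y : ι → ℝ} (hy : y ∈ U) (c a b : ι) :
    christoffel h c a b y
      = -(1 / 2) * (matrixDeriv b (fun y => (h y)⁻¹) y * h y) c a := by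
  rw [H.matrixDeriv_inv_mul hy, christoffel, Matrix.neg_apply, Matrix.mul_apply, neg_mul_neg]
  congr 1
  refine Finset.sum_congr rfl fun d _ => ?_
  simp only [← matrixDeriv_apply]
  rw [H.codazzi y hy a d b, H.matrixDeriv_symm hy b d a]
  ring

lemma christoffel_inl_inl_inl (H : IsHessianMetric U h) (hz : z ∘ Sum.inl ∈ U) (c a b : ι) :
    christoffel (torusInvariantMetric h) (Sum.inl c) (Sum.inl a) (Sum.inl b) z
      = -(1 / 2) * (matrixDeriv b (fun y => (h y)⁻¹) (z ∘ Sum.inl) * h (z ∘ Sum.inl)) c a := by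
  rw [← H.christoffel_eq hz]
  simp [christoffel, H.inv_torusInvariantMetric hz, H.coordDeriv_inl_metric_inl hz,
    matrixDeriv_apply]

/-- The symbol `Γ^{x_c}_{θ_a θ_b} = -(1/2) h^{cd} ∂_d h^{ab}`, with `c` and `a` exchanged by total
symmetry, so that its divergence over `c` involves `∂_c h^{cb}`. -/
lemma christoffel_inl_inr_inr (H : IsHessianMetric U h) (hz : z ∘ Sum.inl ∈ U) (c a b : ι) :
    christoffel (torusInvariantMetric h) (Sum.inl c) (Sum.inr a) (Sum.inr b) z
      = -(1 / 2) * ∑ d, (h (z ∘ Sum.inl))⁻¹ a d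
        * matrixDeriv d (fun y => (h y)⁻¹) (z ∘ Sum.inl) c b := by
  rw [H.sum_inv_mul_matrixDeriv_inv_comm hz]
  simp [christoffel, H.inv_torusInvariantMetric hz, H.coordDeriv_inl_metric_inr hz,
    coordDeriv_metric_inl_inr, coordDeriv_metric_inr_inl]

lemma christoffel_inr_inl_inr (H : IsHessianMetric U h) (hz : z ∘ Sum.inl ∈ U) (c a b : ι) :
    christoffel (torusInvariantMetric h) (Sum.inr c) (Sum.inl a) (Sum.inr b) z
      = (1 / 2) * (h (z ∘ Sum.inl) * matrixDeriv a (fun y => (h y)⁻¹) (z ∘ Sum.inl)) c b := by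
  simp [christoffel, H.inv_torusInvariantMetric hz, H.coordDeriv_inl_metric_inr hz,
    coordDeriv_metric_inl_inr, Matrix.mul_apply]

lemma christoffel_inr_inr_inl (H : IsHessianMetric U h) (hz : z ∘ Sum.inl ∈ U) (c a b : ι) :
    christoffel (torusInvariantMetric h) (Sum.inr c) (Sum.inr a) (Sum.inl b) z
      = (1 / 2) * (h (z ∘ Sum.inl) * matrixDeriv b (fun y => (h y)⁻¹) (z ∘ Sum.inl)) c a := by
  simp [christoffel, H.inv_torusInvariantMetric hz, H.coordDeriv_inl_metric_inr hz,
    coordDeriv_metric_inr_inl, Matrix.mul_apply, H.matrixDeriv_inv_symm hz b a]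

lemma christoffel_inr_inl_inl (H : IsHessianMetric U h) (hz : z ∘ Sum.inl ∈ U) (c a b : ι) :
    christoffel (torusInvariantMetric h) (Sum.inr c) (Sum.inl a) (Sum.inl b) z = 0 := by
  simp [christoffel, H.inv_torusInvariantMetric hz, H.coordDeriv_inr_metric_inl hz,
    coordDeriv_metric_inr_inl, coordDeriv_metric_inl_inr]

lemma christoffel_inl_inl_inr (H : IsHessianMetric U h) (hz : z ∘ Sum.inl ∈ U) (c a b : ι) :
    christoffel (torusInvariantMetric h) (Sum.inl c) (Sum.inl a) (Sum.inr b) z = 0 := by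
  simp [christoffel, H.inv_torusInvariantMetric hz, H.coordDeriv_inr_metric_inl hz,
    coordDeriv_metric_inl_inr]

lemma christoffel_inl_inr_inl (H : IsHessianMetric U h) (hz : z ∘ Sum.inl ∈ U) (c a b : ι) :
    christoffel (torusInvariantMetric h) (Sum.inl c) (Sum.inr a) (Sum.inl b) z = 0 := by
  simp [christoffel, H.inv_torusInvariantMetric hz, H.coordDeriv_inr_metric_inl hz,
    coordDeriv_metric_inr_inl]

lemma christoffel_inr_inr_inr (H : IsHessianMetric U h) (hz : z ∘ Sum.inl ∈ U) (c a b : ι) :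
    christoffel (torusInvariantMetric h) (Sum.inr c) (Sum.inr a) (Sum.inr b) z = 0 := by
  simp [christoffel, H.inv_torusInvariantMetric hz, H.coordDeriv_inr_metric_inr hz]

end IsHessianMetric
end HessianKahler

/-! ### Ricci tensor of the Kähler metric of a Hessian metric -/

section HessianRicci

open Filter Topology

variable {ι : Type*} [Fintype ι] [DecidableEq ι]

namespace IsHessianMetric

variable {U : Set (ι → ℝ)} {h : (ι → ℝ) → Matrix ι ι ℝ} {z : ι ⊕ ι → ℝ}

/-- The coordinates `(x, θ)` are unimodular: `Γ^a_{ac} = 0`, because the metric has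
determinant `1`. -/
lemma sum_christoffel_eq_zero (H : IsHessianMetric U h) (hz : z ∘ Sum.inl ∈ U) (c : ι ⊕ ι) :
    ∑ a, christoffel (torusInvariantMetric h) a a c z = 0 := by
  rw [Fintype.sum_sum_type]
  cases c with
  | inl c =>
    simp only [H.christoffel_inl_inl_inl hz, H.christoffel_inr_inr_inl hz, ← Finset.mul_sum]
    have := Matrix.trace_mul_comm (matrixDeriv c (fun y => (h y)⁻¹) (z ∘ Sum.inl))
      (h (z ∘ Sum.inl))
    simp only [Matrix.trace, Matrix.diag] at this
    rw [this]
    ring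
  | inr c => simp [H.christoffel_inl_inl_inr hz, H.christoffel_inr_inr_inr hz]

lemma differentiableAt_matrixDeriv_inv_mul (H : IsHessianMetric U h) {y : ι → ℝ} (hy : y ∈ U)
    (a i j : ι) :
    DifferentiableAt ℝ (fun y => (matrixDeriv a (fun y => (h y)⁻¹) y * h y) i j) y :=
  H.differentiableAt (ContDiffOn.sum fun k _ =>
    (H.smooth_matrixDeriv_inv a i k).mul (H.smooth k j)) hy

lemma differentiableAt_mul_matrixDeriv_inv (H : IsHessianMetric U h) {y : ι → ℝ} (hy : y ∈ U)
    (a i j : ι) :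
    DifferentiableAt ℝ (fun y => (h y * matrixDeriv a (fun y => (h y)⁻¹) y) i j) y :=
  H.differentiableAt (ContDiffOn.sum fun k _ =>
    (H.smooth i k).mul (H.smooth_matrixDeriv_inv a k j)) hy

lemma differentiableAt_christoffel (H : IsHessianMetric U h) (hz : z ∘ Sum.inl ∈ U)
    (a c : ι ⊕ ι) : DifferentiableAt ℝ (christoffel (torusInvariantMetric h) a a c) z := by
  rcases a with a | a <;> rcases c with c | c
  · exact (hasFDerivAt_of_eq_comp_inl H.isOpen (fun y hy => H.christoffel_inl_inl_inl hy a a c) hz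
      ((H.differentiableAt_matrixDeriv_inv_mul hz c a a).const_mul _)).differentiableAt
  · exact (hasFDerivAt_of_eq_comp_inl (f := fun _ => 0) H.isOpen
      (fun y hy => H.christoffel_inl_inl_inr hy a a c) hz
      (differentiableAt_const _)).differentiableAt
  · exact (hasFDerivAt_of_eq_comp_inl H.isOpen (fun y hy => H.christoffel_inr_inr_inl hy a a c) hz
      ((H.differentiableAt_mul_matrixDeriv_inv hz c a a).const_mul _)).differentiableAt
  · exact (hasFDerivAt_of_eq_comp_inl (f := fun _ => 0) H.isOpen
      (fun y hy => H.christoffel_inr_inr_inr hy a a c) hz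
      (differentiableAt_const _)).differentiableAt

lemma ricciTensor_eq (H : IsHessianMetric U h) (hz : z ∘ Sum.inl ∈ U) (b c : ι ⊕ ι) :
    ricciTensor (torusInvariantMetric h) z b c
      = ∑ a, coordDeriv a (christoffel (torusInvariantMetric h) a b c) z
        - ∑ a, ∑ e, christoffel (torusInvariantMetric h) a b e z
          * christoffel (torusInvariantMetric h) e a c z :=
  ricciTensor_of_sum_christoffel_eq_zero
    ((eventually_comp_inl_mem H.isOpen hz).mono fun _ hy => H.sum_christoffel_eq_zero hy)
    (H.differentiableAt_christoffel hz) b c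

lemma ricciTensor_inl_inr (H : IsHessianMetric U h) (hz : z ∘ Sum.inl ∈ U) (b c : ι) :
    ricciTensor (torusInvariantMetric h) z (Sum.inl b) (Sum.inr c) = 0 := by
  have h1 : ∀ a, coordDeriv (Sum.inl a)
      (christoffel (torusInvariantMetric h) (Sum.inl a) (Sum.inl b) (Sum.inr c)) z = 0 := fun a =>
    (coordDeriv_inl_of_eq_comp_inl (f := fun _ => 0) H.isOpen
      (fun y hy => H.christoffel_inl_inl_inr hy a b c) hz (differentiableAt_const _) a).trans
      (coordDeriv_const _ _ _)
  have h2 : ∀ a, coordDeriv (Sum.inr a)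
      (christoffel (torusInvariantMetric h) (Sum.inr a) (Sum.inl b) (Sum.inr c)) z = 0 := fun a =>
    coordDeriv_inr_of_eq_comp_inl H.isOpen (fun y hy => H.christoffel_inr_inl_inr hy a b c) hz
      ((H.differentiableAt_mul_matrixDeriv_inv hz b a c).const_mul _) a
  simp [H.ricciTensor_eq hz, h1, h2, H.christoffel_inl_inl_inr hz, H.christoffel_inr_inl_inl hz,
    H.christoffel_inr_inr_inr hz]

lemma ricciTensor_inr_inl (H : IsHessianMetric U h) (hz : z ∘ Sum.inl ∈ U) (b c : ι) :
    ricciTensor (torusInvariantMetric h) z (Sum.inr b) (Sum.inl c) = 0 := by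
  have h1 : ∀ a, coordDeriv (Sum.inl a)
      (christoffel (torusInvariantMetric h) (Sum.inl a) (Sum.inr b) (Sum.inl c)) z = 0 := fun a =>
    (coordDeriv_inl_of_eq_comp_inl (f := fun _ => 0) H.isOpen
      (fun y hy => H.christoffel_inl_inr_inl hy a b c) hz (differentiableAt_const _) a).trans
      (coordDeriv_const _ _ _)
  have h2 : ∀ a, coordDeriv (Sum.inr a)
      (christoffel (torusInvariantMetric h) (Sum.inr a) (Sum.inr b) (Sum.inl c)) z = 0 := fun a =>
    coordDeriv_inr_of_eq_comp_inl H.isOpen (fun y hy => H.christoffel_inr_inr_inl hy a b c) hz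
      ((H.differentiableAt_mul_matrixDeriv_inv hz c a b).const_mul _) a
  simp [H.ricciTensor_eq hz, h1, h2, H.christoffel_inl_inr_inl hz, H.christoffel_inr_inl_inl hz,
    H.christoffel_inr_inr_inr hz]

lemma matrixDeriv_inv_mul_comm (H : IsHessianMetric U h) {y : ι → ℝ} (hy : y ∈ U) (a b c : ι) :
    (matrixDeriv b (fun y => (h y)⁻¹) y * h y) c a
      = (matrixDeriv a (fun y => (h y)⁻¹) y * h y) c b := by
  rw [H.matrixDeriv_inv_mul hy, H.matrixDeriv_inv_mul hy]
  simp only [Matrix.neg_apply, Matrix.mul_apply]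
  refine congrArg Neg.neg (Finset.sum_congr rfl fun d _ => ?_)
  rw [H.matrixDeriv_symm hy b, H.matrixDeriv_symm hy a, H.codazzi y hy b a d]

/-- The divergence `∂_a Γ^a_{x_b x_c}`: a derivative of the gradient of `log V`, plus a term
quadratic in first derivatives. -/
lemma sum_coordDeriv_christoffel_inl_inl (H : IsHessianMetric U h) (hz : z ∘ Sum.inl ∈ U)
    (b c : ι) :
    ∑ a, coordDeriv a (christoffel (torusInvariantMetric h) a (Sum.inl b) (Sum.inl c)) z
      = -∑ d, h (z ∘ Sum.inl) b d * coordDeriv c (logVolumeGradient h d) (z ∘ Sum.inl)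
        - (1 / 2) * (matrixDeriv b h (z ∘ Sum.inl)
          * matrixDeriv c (fun y => (h y)⁻¹) (z ∘ Sum.inl)).trace := by
  have hr : ∀ a, coordDeriv (Sum.inr a)
      (christoffel (torusInvariantMetric h) (Sum.inr a) (Sum.inl b) (Sum.inl c)) z = 0 := fun a =>
    coordDeriv_inr_of_eq_comp_inl (f := fun _ => 0) H.isOpen
      (fun y hy => H.christoffel_inr_inl_inl hy a b c) hz (differentiableAt_const _) a
  have hl : ∀ a, coordDeriv (Sum.inl a)
      (christoffel (torusInvariantMetric h) (Sum.inl a) (Sum.inl b) (Sum.inl c)) z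
      = -(1 / 2) * ∑ d, (coordDeriv a (fun y => matrixDeriv c (fun y => (h y)⁻¹) y a d)
          (z ∘ Sum.inl) * h (z ∘ Sum.inl) d b
        + matrixDeriv c (fun y => (h y)⁻¹) (z ∘ Sum.inl) a d
          * matrixDeriv b h (z ∘ Sum.inl) d a) := by
    intro a
    have hd := H.differentiableAt_matrixDeriv_inv_mul hz c a b
    rw [coordDeriv_inl_of_eq_comp_inl H.isOpen (fun y hy => H.christoffel_inl_inl_inl hy a b c) hz
      (hd.const_mul _), coordDeriv_const_mul _ _ hd]
    simp only [Matrix.mul_apply]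
    rw [coordDeriv_sum _ _ fun d _ =>
      (H.differentiableAt (H.smooth_matrixDeriv_inv c a d) hz).fun_mul
        (H.differentiableAt (H.smooth d b) hz)]
    congr 1
    refine Finset.sum_congr rfl fun d _ => ?_
    rw [coordDeriv_mul _ (H.differentiableAt (H.smooth_matrixDeriv_inv c a d) hz)
      (H.differentiableAt (H.smooth d b) hz), ← matrixDeriv_apply a h, H.matrixDeriv_symm hz a d b,
      H.codazzi _ hz a b d, H.matrixDeriv_symm hz b a d]
  have h1 : ∑ a, ∑ d, coordDeriv a (fun y => matrixDeriv c (fun y => (h y)⁻¹) y a d)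
      (z ∘ Sum.inl) * h (z ∘ Sum.inl) d b
      = 2 * ∑ d, h (z ∘ Sum.inl) b d * coordDeriv c (logVolumeGradient h d) (z ∘ Sum.inl) := by
    rw [Finset.sum_comm, Finset.mul_sum]
    refine Finset.sum_congr rfl fun d _ => ?_
    rw [← Finset.sum_mul, H.sum_coordDeriv_matrixDeriv_inv hz, H.symm hz d b]
    ring
  rw [Fintype.sum_sum_type]
  simp only [hr, hl, Finset.sum_const_zero, add_zero, ← Finset.mul_sum, Finset.sum_add_distrib, h1]
  rw [Matrix.trace_mul_comm]
  simp only [Matrix.trace, Matrix.diag, Matrix.mul_apply]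
  ring

lemma trace_matrixDeriv_mul_matrixDeriv_inv (H : IsHessianMetric U h) {y : ι → ℝ} (hy : y ∈ U)
    (b c : ι) :
    (h y * matrixDeriv b (fun y => (h y)⁻¹) y * (h y * matrixDeriv c (fun y => (h y)⁻¹) y)).trace
      = -(matrixDeriv b h y * matrixDeriv c (fun y => (h y)⁻¹) y).trace := by
  rw [H.mul_matrixDeriv_inv hy b, Matrix.neg_mul, Matrix.mul_assoc, ← Matrix.mul_assoc _ (h y),
    H.inv_mul hy, Matrix.one_mul, Matrix.trace_neg]

/-- The quadratic term `Γ^a_{be} Γ^e_{ac}` of `Ric(∂_{x_b}, ∂_{x_c})`. The indices `a`, `e` are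
both of type `x` or both of type `θ`, and the two cases contribute equally. -/
lemma sum_christoffel_mul_christoffel_inl_inl (H : IsHessianMetric U h) (hz : z ∘ Sum.inl ∈ U)
    (b c : ι) :
    ∑ a, ∑ e, christoffel (torusInvariantMetric h) a (Sum.inl b) e z
        * christoffel (torusInvariantMetric h) e a (Sum.inl c) z
      = -(1 / 2) * (matrixDeriv b h (z ∘ Sum.inl)
          * matrixDeriv c (fun y => (h y)⁻¹) (z ∘ Sum.inl)).trace := by
  have h2 := H.trace_matrixDeriv_mul_matrixDeriv_inv hz b c
  -- Cyclicity of the trace also gives the version with the factors `h` on the right.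
  have h1 := h2
  rw [Matrix.mul_assoc, Matrix.trace_mul_comm, Matrix.mul_assoc, Matrix.mul_assoc (h _),
    ← Matrix.mul_assoc] at h1
  have htr : ∀ A B : Matrix ι ι ℝ, (A * B).trace = ∑ i, ∑ j, A i j * B j i := fun _ _ => rfl
  rw [htr (_ * _) (_ * _)] at h1 h2
  have hl : ∀ a e, christoffel (torusInvariantMetric h) (Sum.inl a) (Sum.inl b) (Sum.inl e) z
      = -(1 / 2) * (matrixDeriv b (fun y => (h y)⁻¹) (z ∘ Sum.inl) * h (z ∘ Sum.inl)) a e :=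
    fun a e => by rw [H.christoffel_inl_inl_inl hz, H.matrixDeriv_inv_mul_comm hz]
  simp only [Fintype.sum_sum_type, hl, H.christoffel_inl_inl_inr hz,
    H.christoffel_inr_inl_inl hz, H.christoffel_inr_inl_inr hz, H.christoffel_inr_inr_inl hz,
    H.christoffel_inl_inl_inl hz _ _ c,
    zero_mul, Finset.sum_const_zero, add_zero, zero_add]
  simp only [mul_mul_mul_comm _ _ (_ : ℝ), ← Finset.mul_sum]
  rw [h1, h2]
  ring

/-- The `dx^b ⊗ dx^c` component of the Ricci tensor. -/
lemma ricciTensor_inl_inl (H : IsHessianMetric U h) (hz : z ∘ Sum.inl ∈ U) (b c : ι) :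
    ricciTensor (torusInvariantMetric h) z (Sum.inl b) (Sum.inl c)
      = -∑ d, h (z ∘ Sum.inl) b d * coordDeriv c (logVolumeGradient h d) (z ∘ Sum.inl) := by
  rw [H.ricciTensor_eq hz, H.sum_coordDeriv_christoffel_inl_inl hz,
    H.sum_christoffel_mul_christoffel_inl_inl hz]
  ring

/-- The divergence `∂_a Γ^a_{θ_b θ_c}`: a derivative of the gradient of `log V`, plus a term
quadratic in first derivatives. -/
lemma sum_coordDeriv_christoffel_inr_inr (H : IsHessianMetric U h) (hz : z ∘ Sum.inl ∈ U)
    (b c : ι) :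
    ∑ a, coordDeriv a (christoffel (torusInvariantMetric h) a (Sum.inr b) (Sum.inr c)) z
      = -∑ d, (h (z ∘ Sum.inl))⁻¹ b d * coordDeriv d (logVolumeGradient h c) (z ∘ Sum.inl)
        - (1 / 2) * ∑ a, ∑ d, matrixDeriv a (fun y => (h y)⁻¹) (z ∘ Sum.inl) b d
          * matrixDeriv d (fun y => (h y)⁻¹) (z ∘ Sum.inl) a c := by
  have hr : ∀ a, coordDeriv (Sum.inr a)
      (christoffel (torusInvariantMetric h) (Sum.inr a) (Sum.inr b) (Sum.inr c)) z = 0 := fun a =>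
    coordDeriv_inr_of_eq_comp_inl (f := fun _ => 0) H.isOpen
      (fun y hy => H.christoffel_inr_inr_inr hy a b c) hz (differentiableAt_const _) a
  have hl : ∀ a, coordDeriv (Sum.inl a)
      (christoffel (torusInvariantMetric h) (Sum.inl a) (Sum.inr b) (Sum.inr c)) z
      = -(1 / 2) * ∑ d, (matrixDeriv a (fun y => (h y)⁻¹) (z ∘ Sum.inl) b d
          * matrixDeriv d (fun y => (h y)⁻¹) (z ∘ Sum.inl) a c
        + (h (z ∘ Sum.inl))⁻¹ b d * coordDeriv a
          (fun y => matrixDeriv d (fun y => (h y)⁻¹) y a c) (z ∘ Sum.inl)) := by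
    intro a
    have h1 := fun d => H.differentiableAt (H.smooth_inv b d) hz
    have h2 := fun d => H.differentiableAt (H.smooth_matrixDeriv_inv d a c) hz
    have hd := DifferentiableAt.fun_sum (u := Finset.univ) fun d _ => (h1 d).fun_mul (h2 d)
    rw [coordDeriv_inl_of_eq_comp_inl H.isOpen (fun y hy => H.christoffel_inl_inr_inr hy a b c) hz
      (hd.const_mul _), coordDeriv_const_mul _ _ hd,
      coordDeriv_sum _ _ fun d _ => (h1 d).fun_mul (h2 d)]
    congr 1
    exact Finset.sum_congr rfl fun d _ => coordDeriv_mul _ (h1 d) (h2 d)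
  have h1 : ∑ a, ∑ d, (h (z ∘ Sum.inl))⁻¹ b d * coordDeriv a
      (fun y => matrixDeriv d (fun y => (h y)⁻¹) y a c) (z ∘ Sum.inl)
      = 2 * ∑ d, (h (z ∘ Sum.inl))⁻¹ b d * coordDeriv d (logVolumeGradient h c) (z ∘ Sum.inl) := by
    rw [Finset.sum_comm, Finset.mul_sum]
    refine Finset.sum_congr rfl fun d _ => ?_
    rw [← Finset.mul_sum, H.sum_coordDeriv_matrixDeriv_inv hz]
    ring
  rw [Fintype.sum_sum_type]
  simp only [hr, hl, Finset.sum_const_zero, add_zero, ← Finset.mul_sum, Finset.sum_add_distrib, h1]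
  ring

/-- Raising the index of `v` and lowering it again by contraction with `h * B`. -/
lemma sum_inv_mul_sum_mul (H : IsHessianMetric U h) {y : ι → ℝ} (hy : y ∈ U) (v : ι → ℝ)
    (B : Matrix ι ι ℝ) (c : ι) :
    ∑ e, (∑ d, (h y)⁻¹ e d * v d) * (h y * B) e c = ∑ d, v d * B d c := by
  have : (v ᵥ* (h y)⁻¹) ᵥ* (h y * B) = v ᵥ* B := by
    rw [Matrix.vecMul_vecMul, ← Matrix.mul_assoc, H.inv_mul hy, Matrix.one_mul]
  simpa only [Matrix.vecMul, dotProduct, H.inv_symm hy, mul_comm] using congrFun this c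

/-- The quadratic term `Γ^a_{be} Γ^e_{ac}` of `Ric(∂_{θ_b}, ∂_{θ_c})`. One of the indices `a`, `e`
is of type `x` and the other of type `θ`, and the two cases contribute equally. -/
lemma sum_christoffel_mul_christoffel_inr_inr (H : IsHessianMetric U h) (hz : z ∘ Sum.inl ∈ U)
    (b c : ι) :
    ∑ a, ∑ e, christoffel (torusInvariantMetric h) a (Sum.inr b) e z
        * christoffel (torusInvariantMetric h) e a (Sum.inr c) z
      = -(1 / 2) * ∑ a, ∑ d, matrixDeriv a (fun y => (h y)⁻¹) (z ∘ Sum.inl) b d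
          * matrixDeriv d (fun y => (h y)⁻¹) (z ∘ Sum.inl) a c := by
  have h1 : ∀ a, ∑ e, (∑ d, (h (z ∘ Sum.inl))⁻¹ b d
        * matrixDeriv d (fun y => (h y)⁻¹) (z ∘ Sum.inl) a e)
        * (h (z ∘ Sum.inl) * matrixDeriv a (fun y => (h y)⁻¹) (z ∘ Sum.inl)) e c
      = ∑ d, matrixDeriv a (fun y => (h y)⁻¹) (z ∘ Sum.inl) d c
        * matrixDeriv d (fun y => (h y)⁻¹) (z ∘ Sum.inl) b a := by
    intro a
    refine Eq.trans ?_ ((H.sum_inv_mul_sum_mul hz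
      (fun d => matrixDeriv d (fun y => (h y)⁻¹) (z ∘ Sum.inl) b a) _ c).trans
      (Finset.sum_congr rfl fun d _ => mul_comm _ _))
    refine Finset.sum_congr rfl fun e _ => ?_
    rw [H.sum_inv_mul_matrixDeriv_inv_comm hz b a e]
    simp only [H.matrixDeriv_inv_symm hz _ a e]
  have h2 : ∀ e, ∑ a, (h (z ∘ Sum.inl) * matrixDeriv e (fun y => (h y)⁻¹) (z ∘ Sum.inl)) a b
        * (∑ d, (h (z ∘ Sum.inl))⁻¹ a d * matrixDeriv d (fun y => (h y)⁻¹) (z ∘ Sum.inl) e c)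
      = ∑ d, matrixDeriv e (fun y => (h y)⁻¹) (z ∘ Sum.inl) b d
        * matrixDeriv d (fun y => (h y)⁻¹) (z ∘ Sum.inl) e c := by
    intro e
    refine (Finset.sum_congr rfl fun a _ => mul_comm _ _).trans ((H.sum_inv_mul_sum_mul hz
      (fun d => matrixDeriv d (fun y => (h y)⁻¹) (z ∘ Sum.inl) e c) _ b).trans
      (Finset.sum_congr rfl fun d _ => ?_))
    rw [H.matrixDeriv_inv_symm hz e b d, mul_comm]
  simp only [Fintype.sum_sum_type, H.christoffel_inl_inr_inl hz, H.christoffel_inl_inr_inr hz,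
    H.christoffel_inr_inr_inl hz, H.christoffel_inr_inr_inr hz, H.christoffel_inr_inl_inr hz,
    zero_mul, Finset.sum_const_zero, add_zero, zero_add]
  simp only [mul_mul_mul_comm _ _ (_ : ℝ), ← Finset.mul_sum, h1]
  rw [Finset.sum_comm (f := fun a e => (h (z ∘ Sum.inl)
    * matrixDeriv e (fun y => (h y)⁻¹) (z ∘ Sum.inl)) a b * _)]
  simp only [h2]
  rw [Finset.sum_comm]
  simp only [mul_comm (matrixDeriv _ _ _ _ c)]
  ring

/-- The `dθ^b ⊗ dθ^c` component of the Ricci tensor. -/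
lemma ricciTensor_inr_inr (H : IsHessianMetric U h) (hz : z ∘ Sum.inl ∈ U) (b c : ι) :
    ricciTensor (torusInvariantMetric h) z (Sum.inr b) (Sum.inr c)
      = -∑ d, (h (z ∘ Sum.inl))⁻¹ b d
        * coordDeriv d (logVolumeGradient h c) (z ∘ Sum.inl) := by
  rw [H.ricciTensor_eq hz, H.sum_coordDeriv_christoffel_inr_inr hz,
    H.sum_christoffel_mul_christoffel_inr_inr hz]
  ring

end IsHessianMetric
end HessianRicci

/-! ### The Hessian of the logarithmic volume -/

/-- At a critical point of `log V` the Christoffel term of the Hessian and the derivative of `h⁻¹`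
in the gradient are both multiplied by zero. -/
lemma IsHessianMetric.sum_mul_coordDeriv_logVolumeGradient {ι : Type*} [Fintype ι] [DecidableEq ι]
    {U : Set (ι → ℝ)} {h : (ι → ℝ) → Matrix ι ι ℝ} (H : IsHessianMetric U h) {y : ι → ℝ}
    (hy : y ∈ U) (h0 : ∀ c, coordDeriv c (logVolume h) y = 0) (i j : ι) :
    ∑ d, h y i d * coordDeriv j (logVolumeGradient h d) y
      = riemannianHessian h (logVolume h) y i j := by
  have hs := fun p => contDiffOn_coordDeriv H.isOpen H.smooth_logVolume p
  have h1 : ∀ d, coordDeriv j (logVolumeGradient h d) y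
      = ∑ p, (h y)⁻¹ d p * coordDeriv j (coordDeriv p (logVolume h)) y := by
    intro d
    have e : logVolumeGradient h d = fun y => ∑ p, (h y)⁻¹ d p * coordDeriv p (logVolume h) y := rfl
    rw [e, coordDeriv_sum _ _ fun p _ => (H.differentiableAt (H.smooth_inv d p) hy).fun_mul
      (H.differentiableAt (hs p) hy)]
    refine Finset.sum_congr rfl fun p _ => ?_
    rw [coordDeriv_mul _ (H.differentiableAt (H.smooth_inv d p) hy)
      (H.differentiableAt (hs p) hy), h0, mul_zero, zero_add]
  have h2 : h y *ᵥ ((h y)⁻¹ *ᵥ fun p => coordDeriv j (coordDeriv p (logVolume h)) y)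
      = fun p => coordDeriv j (coordDeriv p (logVolume h)) y := by
    rw [Matrix.mulVec_mulVec, H.mul_inv hy, Matrix.one_mulVec]
  simp only [h1, riemannianHessian, h0, mul_zero, Finset.sum_const_zero, sub_zero]
  rw [coordDeriv_comm H.isOpen H.smooth_logVolume hy i j]
  exact congrFun h2 i

/-! ### Toric Kähler metrics in action-angle coordinates -/

lemma isHessianMetric_hessMatrix {n : ℕ} {U : Set (Fin n → ℝ)} (hU : IsOpen U)
    {u : (Fin n → ℝ) → ℝ} (hu : ContDiffOn ℝ ∞ u U) (hpos : ∀ x ∈ U, (hessMatrix u x).PosDef) :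
    IsHessianMetric U (hessMatrix u) where
  isOpen := hU
  smooth i j := contDiffOn_coordDeriv hU (contDiffOn_coordDeriv hU hu j) i
  posDef := hpos
  codazzi _ hy a b c := coordDeriv_comm hU (contDiffOn_coordDeriv hU hu c) hy a b

theorem mainTheorem7 {n : ℕ}
    {E : Type*} [NormedAddCommGroup E] [NormedSpace ℝ E]
    {M : Type*} [TopologicalSpace M] [ChartedSpace E M] [IsManifold 𝓘(ℝ, E) ∞ M]
    [AddAction (Fin n → Real.Angle) M] (K : ToricKahler n E M)
    (U : Set (Fin n → ℝ)) (Φ : (Fin n ⊕ Fin n → ℝ) → M) (hΦ : IsActionAngle K U Φ)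
    (u : (Fin n → ℝ) → ℝ) (hu : IsSymplecticPotential K U Φ u)
    (x θ : Fin n → ℝ) (hx : x ∈ U) :
    (∀ i j : Fin n,
      ricciTensor (metricCoeff K.g Φ) (Sum.elim x θ) (Sum.inl i) (Sum.inl j) =
        -∑ l, ∑ k, hessMatrix u x i l * coordDeriv j (fun y => (hessMatrix u y)⁻¹ l k *
          coordDeriv k (fun y' => Real.log (orbitVolume u y')) y) x) ∧
    (∀ i j : Fin n,
      ricciTensor (metricCoeff K.g Φ) (Sum.elim x θ) (Sum.inr i) (Sum.inr j) =
        -∑ k, ∑ l, (hessMatrix u x)⁻¹ i k * coordDeriv k (fun y => (hessMatrix u y)⁻¹ j l *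
          coordDeriv l (fun y' => Real.log (orbitVolume u y')) y) x) ∧
    (∀ i j : Fin n,
      ricciTensor (metricCoeff K.g Φ) (Sum.elim x θ) (Sum.inl i) (Sum.inr j) = 0 ∧
      ricciTensor (metricCoeff K.g Φ) (Sum.elim x θ) (Sum.inr i) (Sum.inl j) = 0) ∧
    (fderiv ℝ (orbitVolume u) x = 0 → ∀ i j : Fin n,
      ricciTensor (metricCoeff K.g Φ) (Sum.elim x θ) (Sum.inl i) (Sum.inl j) =
        -riemannianHessian (hessMatrix u) (fun y => Real.log (orbitVolume u y)) x i j) := by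
  have H := isHessianMetric_hessMatrix hΦ.isOpen hu.smooth hu.posDef
  have hz : (Sum.elim x θ : Fin n ⊕ Fin n → ℝ) ∘ Sum.inl ∈ U := by simpa using hx
  have hG := fun b c => ricciTensor_congr
    ((eventually_comp_inl_mem H.isOpen hz).mono hu.metric :
      metricCoeff K.g Φ =ᶠ[nhds (Sum.elim x θ)] torusInvariantMetric (hessMatrix u)) b c
  have hlog : (fun y => Real.log (orbitVolume u y)) = logVolume (hessMatrix u) := rfl
  have hgrad : ∀ c k, coordDeriv k (logVolumeGradient (hessMatrix u) c) x
      = ∑ l, coordDeriv k (fun y => (hessMatrix u y)⁻¹ c l *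
          coordDeriv l (logVolume (hessMatrix u)) y) x := fun c k =>
    coordDeriv_sum _ _ fun l _ => (H.differentiableAt (H.smooth_inv c l) hx).fun_mul
      (H.differentiableAt (contDiffOn_coordDeriv H.isOpen H.smooth_logVolume l) hx)
  have hxx := fun i j => (hG _ _).trans (H.ricciTensor_inl_inl hz i j)
  have hθθ := fun i j => (hG _ _).trans (H.ricciTensor_inr_inr hz i j)
  simp only [Sum.elim_comp_inl] at hxx hθθ
  simp only [hlog]
  refine ⟨fun i j => ?_, fun i j => ?_, fun i j => ⟨(hG _ _).trans (H.ricciTensor_inl_inr hz i j),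
    (hG _ _).trans (H.ricciTensor_inr_inl hz i j)⟩, fun hcrit i j => ?_⟩
  · simp only [hxx, hgrad, Finset.mul_sum]
  · simp only [hθθ, hgrad, Finset.mul_sum]
  · have hd : DifferentiableAt ℝ (orbitVolume u) x :=
      (H.differentiableAt (contDiffOn_det H.smooth) hx).rpow_const (Or.inl (H.det_pos hx).ne')
    have h0 : ∀ c, coordDeriv c (logVolume (hessMatrix u)) x = 0 := fun c => by
      rw [← hlog, coordDeriv_log c hd (Real.rpow_pos_of_pos (H.det_pos hx) _).ne']
      simp [coordDeriv, hcrit]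
    rw [hxx, H.sum_mul_coordDeriv_logVolumeGradient hx h0]
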